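/- Let $K$ be a compact metric space and let $\xi_1,\xi_2$ be countable ordinals. A function $f:K\to\mathbb R$ is Baire-1 if it is the pointwise limit of a sequence of continuous real-valued functions on $K$. For $f:K\to\mathbb R$ and $\varepsilon>0$ put $K^0(f,\varepsilon)=K$; let $K^{\alpha+1}(f,\varepsilon)$ be the set of $x\in K^\alpha(f,\varepsilon)$ such that every open $U\ni x$ contains points $x_1,x_2\in U\cap K^\alpha(f,\varepsilon)$ with $|f(x_1)-f(x_2)|\ge\varepsilon$; and let $K^\alpha(f,\varepsilon)=\bigcap_{\alpha'<\alpha}K^{\alpha'}(f,\varepsilon)$ for limit $\alpha$. Let $\beta(f,\varepsilon)$ be the least countable $\alpha$ with $K^\alpha(f,\varepsilon)=\emptyset$ if there is one, and $\omega_1$ otherwise, and let $\beta(f)=\sup_{\varepsilon>0}\beta(f,\varepsilon)$ (the oscillation index). For a sequence $(f_n)$ of functions $K\to\mathbb R$ define $K^\alpha((f_n),\varepsilon)$, $\gamma((f_n),\varepsilon)$ and the convergence index $\gamma((f_n))=\sup_{\varepsilon>0}\gamma((f_n),\varepsilon)$ in the same way, where now $K^{\alpha+1}((f_n),\varepsilon)$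 is the set of $x\in K^\alpha((f_n),\varepsilon)$ such that for every open $U\ni x$ and every $m\in\mathbb N$ there are $n_1>n_2>m$ and $x'\in U\cap K^\alpha((f_n),\varepsilon)$ with $|f_{n_1}(x')-f_{n_2}(x')|\ge\varepsilon$. Let $\mathfrak B_1^{\xi}(K)$ be the set of Baire-1 functions $f$ on $K$ with $\beta(f)\le\omega^{\xi}$, and $\mathcal B_1^{\xi}(K)$ the set of bounded functions in $\mathfrak B_1^{\xi}(K)$. Let $f:K\to\mathbb R$ be any function. 1. $f\in\mathfrak B_1^{\xi_1+\xi_2}(K)$ if and only if there is a sequence $(f_n)$ in $\mathfrak B_1^{\xi_1}(K)$ converging pointwise to $f$ with $\gamma((f_n))\le\omega^{\xi_2}$. 2. $f\in\mathcal B_1^{\xi_1+\xi_2}(K)$ if and only if $f$ is bounded and there is a sequence $(f_n)$ in $\mathcal B_1^{\xi_1}(K)$ converging pointwise to $f$ with $\gamma((f_n))\le\omega^{\xi_2}$. 3. $f\in\mathcal B_1^{\xi_1+\xi_2}(K)$ if and only if there is a uniformly bounded sequence $(f_n)$ in $\mathcal B_1^{\xi_1}(K)$ converging pointwise to $f$ with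 $\gamma((f_n))\le\omega^{\xi_2}$. -/

import Mathlib

open Filter Topology
open scoped Ordinal

noncomputable section

namespace BaireOne

variable {K : Type*}

/-- The transfinite iterates of an operation `D` on sets, started at `H`:
`H⁰ = H`, `H^(α+1) = D (H^α)`, and `H^α = ⋂_{α' < α} H^α'` for limit `α`. -/
def iter (D : Set K → Set K) (H : Set K) (α : Ordinal.{0}) : Set K :=
  Ordinal.limitRecOn α H (fun _ S => D S) (fun o _ S => ⋂ (a : Ordinal.{0}) (h : a < o), S a h)

theorem iter_zero (D : Set K → Set K) (H : Set K) : iter D H 0 = H := by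
  simp [iter]

theorem iter_succ (D : Set K → Set K) (H : Set K) (α : Ordinal.{0}) :
    iter D H (Order.succ α) = D (iter D H α) := by
  simp [iter]

theorem iter_limit (D : Set K → Set K) (H : Set K) (α : Ordinal.{0})
    (hα : Order.IsSuccLimit α) : iter D H α = ⋂ (a : Ordinal.{0}) (_ : a < α), iter D H a := by
  unfold iter
  rw [Ordinal.limitRecOn_limit _ _ _ _ hα]

open Classical in
/-- The least `α` with `H^α = ∅` if there is a countable such `α`, and `ω₁` otherwise. -/
def rank (D : Set K → Set K) (H : Set K) : Ordinal.{0} :=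
  if ∃ α : Ordinal.{0}, α < ω₁ ∧ iter D H α = ∅ then sInf {α : Ordinal.{0} | iter D H α = ∅}
  else ω₁

theorem rank_le_omega_one (D : Set K → Set K) (H : Set K) : rank D H ≤ ω₁ := by
  unfold rank
  split_ifs with h
  · obtain ⟨α, hα, h⟩ := h
    exact (csInf_le' (show α ∈ {α : Ordinal.{0} | iter D H α = ∅} from h)).trans hα.le
  · exact le_rfl

/-- The points `x` of `S` such that every open `U` containing `x` has two points
`x₁, x₂ ∈ U ∩ S` with `|f x₁ - f x₂| ≥ ε`. -/
def oscDeriv [TopologicalSpace K] (f : K → ℝ) (ε : ℝ) (S : Set K) : Set K :=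
  {x | x ∈ S ∧ ∀ U : Set K, IsOpen U → x ∈ U →
    ∃ x₁ ∈ U ∩ S, ∃ x₂ ∈ U ∩ S, ε ≤ |f x₁ - f x₂|}

/-- The points `x` of `S` such that for every open `U` containing `x` and every `m` there are
`n₁ > n₂ > m` and `x' ∈ U ∩ S` with `|f_{n₁} x' - f_{n₂} x'| ≥ ε`. -/
def convDeriv [TopologicalSpace K] (f : ℕ → K → ℝ) (ε : ℝ) (S : Set K) : Set K :=
  {x | x ∈ S ∧ ∀ U : Set K, IsOpen U → x ∈ U → ∀ m : ℕ,
    ∃ n₁ n₂ : ℕ, n₁ > n₂ ∧ n₂ > m ∧ ∃ x' ∈ U ∩ S, ε ≤ |f n₁ x' - f n₂ x'|}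

/-- The oscillation index `β(f) = sup {β(f, ε) : ε > 0}` of `f` on `K`
(a supremum bounded by `ω₁`). -/
def oscIndex [TopologicalSpace K] (f : K → ℝ) : Ordinal.{0} :=
  ⨆ ε : {ε : ℝ // 0 < ε}, rank (oscDeriv f ε) Set.univ

/-- The convergence index `γ((f_n)) = sup {γ((f_n), ε) : ε > 0}` of `(f_n)` on `K`
(a supremum bounded by `ω₁`). -/
def convIndex [TopologicalSpace K] (f : ℕ → K → ℝ) : Ordinal.{0} :=
  ⨆ ε : {ε : ℝ // 0 < ε}, rank (convDeriv f ε) Set.univ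

/-- The two suprema above are genuine: the families are bounded by `ω₁`. -/
theorem bddAbove_rank (D : {ε : ℝ // 0 < ε} → Set K → Set K) :
    BddAbove (Set.range fun ε => rank (D ε) Set.univ) :=
  ⟨ω₁, by rintro _ ⟨ε, rfl⟩; exact rank_le_omega_one _ _⟩

/-- `(f_n)` converges pointwise to `f`. -/
def PtwiseLim (f : ℕ → K → ℝ) (g : K → ℝ) : Prop :=
  ∀ x : K, Tendsto (fun n => f n x) atTop (𝓝 (g x))

/-- `f` is a pointwise limit of a sequence of real-valued continuous functions. -/
def IsBaireOne [TopologicalSpace K] (f : K → ℝ) : Prop :=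
  ∃ g : ℕ → K → ℝ, (∀ n, Continuous (g n)) ∧ PtwiseLim g f

/-- `f` is bounded. -/
def IsBdd (f : K → ℝ) : Prop := ∃ M : ℝ, ∀ x, |f x| ≤ M

/-- The sequence `(f_n)` is uniformly bounded. -/
def IsUnifBdd (f : ℕ → K → ℝ) : Prop := ∃ M : ℝ, ∀ n x, |f n x| ≤ M

/-- The Baire-1 functions `f` on `K` with `β(f) ≤ ω ^ ξ`. -/
def SmallBaire (K : Type*) [TopologicalSpace K] (ξ : Ordinal.{0}) : Set (K → ℝ) :=
  {f | IsBaireOne f ∧ oscIndex f ≤ ω ^ ξ}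

/-- The bounded Baire-1 functions `f` on `K` with `β(f) ≤ ω ^ ξ`. -/
def BddSmallBaire (K : Type*) [TopologicalSpace K] (ξ : Ordinal.{0}) : Set (K → ℝ) :=
  {f | IsBaireOne f ∧ IsBdd f ∧ oscIndex f ≤ ω ^ ξ}

end BaireOne

end

/-! An index is at most a countable ordinal `o` exactly when, for each `ε`, there is an upper
semicontinuous rank `ρ : K → o` whose level sets are locally `ε`-good: `ρ x` records the stage at
which `x` is lost. This turns derivations into ordinal-valued functions that can be divided and
added.

If `F n → f`, one step of the convergence derivation absorbs `a` steps of the oscillation derivation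
of `f`, because off the convergence derivative `f` is locally uniformly close to a single `F m`.
Hence `β(f) ≤ a * b` (`oscIndex_le_of_ptwiseLim`), and `ω ^ ξ₁ * ω ^ ξ₂ = ω ^ (ξ₁ + ξ₂)`.

Conversely, take a rank `ρ < a * b` for `f` and `ε`, and divide: `ρ = a * α + σ` with `α < b` and `σ
< a`. Replace `f` by an `ε`-close `g` continuous on the levels of `ρ`. On the closed set of points
at distance at least `1/(n+1)` from all points of larger `α`, the quotient `α` is locally constant,
so `σ` is an oscillation rank for `g` there; `g` extends from this set to `G n` on `K` with rank
below `a`. Near each point, on its `α`-level, `G n = g` for all large `n`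
(`exists_seq_eventually_eq_on_levels`).

The approximations for `ε = 2⁻ᵏ` are merged diagonally by truncated corrections. Merging needs
classes closed under Lipschitz combinations; this is where powers of `ω` enter, being closed under
the strictly monotone natural sum of ranks. -/

noncomputable section

namespace BaireOne

/-! ### The natural sum of ordinals -/

theorem natSum_decreasing {a b : Ordinal.{0}} (h : ¬(a = 0 ∧ b = 0)) :
    max (a % ω ^ Ordinal.log ω (max a b)) (b % ω ^ Ordinal.log ω (max a b)) < max a b := by
  have hne : max a b ≠ 0 := fun h0 =>
    h ⟨nonpos_iff_eq_zero.1 (h0 ▸ le_max_left a b), nonpos_iff_eq_zero.1 (h0 ▸ le_max_right a b)⟩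
  have hpos : (ω : Ordinal.{0}) ^ Ordinal.log ω (max a b) ≠ 0 :=
    (Ordinal.opow_pos _ Ordinal.omega0_pos).ne'
  exact (max_lt (Ordinal.mod_lt _ hpos) (Ordinal.mod_lt _ hpos)).trans_le
    (Ordinal.opow_log_le_self _ hne)

open Classical in
/-- The natural (Hessenberg) sum, computed by adding leading coefficients in base `ω`. -/
def natSum (a b : Ordinal.{0}) : Ordinal.{0} :=
  if _h : a = 0 ∧ b = 0 then 0
  else
    ω ^ Ordinal.log ω (max a b) *
        (a / ω ^ Ordinal.log ω (max a b) + b / ω ^ Ordinal.log ω (max a b)) +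
      natSum (a % ω ^ Ordinal.log ω (max a b)) (b % ω ^ Ordinal.log ω (max a b))
termination_by max a b
decreasing_by exact natSum_decreasing _h

/-- The recursion splits at the actual leading exponent; allowing zero coefficients at a common
exponent `e` makes sums with different leading exponents comparable. -/
theorem natSum_eq_of_lt {e a b : Ordinal.{0}} (ha : a < ω ^ (e + 1))
    (hb : b < ω ^ (e + 1)) :
    natSum a b = ω ^ e * (a / ω ^ e + b / ω ^ e) + natSum (a % ω ^ e) (b % ω ^ e) := by
  by_cases h : a < ω ^ e ∧ b < ω ^ e
  · rw [Ordinal.mod_eq_of_lt h.1, Ordinal.mod_eq_of_lt h.2, Ordinal.div_eq_zero_of_lt h.1,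
      Ordinal.div_eq_zero_of_lt h.2]
    simp
  · have hle : ω ^ e ≤ max a b := by
      rw [not_and_or, not_lt, not_lt] at h
      exact le_max_iff.2 h
    have hne : max a b ≠ 0 := ((Ordinal.opow_pos _ Ordinal.omega0_pos).trans_le hle).ne'
    have hlog : Ordinal.log ω (max a b) = e := by
      rw [Ordinal.log_eq_iff Ordinal.one_lt_omega0 hne]
      exact ⟨hle, by simpa using max_lt ha hb⟩
    have h0 : ¬(a = 0 ∧ b = 0) := fun h0 => hne (by simp [h0.1, h0.2])
    rw [natSum, dif_neg h0, hlog]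

theorem div_opow_lt_omega0 {e a : Ordinal.{0}} (ha : a < ω ^ (e + 1)) : a / ω ^ e < ω := by
  rwa [← Ordinal.lt_mul_iff_div_lt (Ordinal.opow_pos _ Ordinal.omega0_pos).ne',
    ← Ordinal.opow_add_one]

/-- Closure and strict monotonicity need a joint induction. At `e + 1`, if the total coefficient of
`ω ^ e` drops, the sum drops because the remainders contribute less than `ω ^ e`; otherwise both
coefficients agree and the remainders decide. -/
theorem natSum_spec (ξ : Ordinal.{0}) : ∀ a b : Ordinal.{0}, a < ω ^ ξ → b < ω ^ ξ →
    natSum a b < ω ^ ξ ∧ ∀ a' b' : Ordinal.{0}, a' ≤ a → b' ≤ b →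
      natSum a' b' ≤ natSum a b ∧ (natSum a' b' = natSum a b → a' = a ∧ b' = b) := by
  induction ξ using Ordinal.limitRecOn with
  | zero =>
    intro a b ha hb
    simp only [Ordinal.opow_zero, Order.lt_one_iff] at ha hb
    subst ha hb
    refine ⟨by rw [natSum]; simp, fun a' b' ha hb => ?_⟩
    rw [nonpos_iff_eq_zero] at ha hb
    simp [ha, hb]
  | add_one e ih =>
    intro a b ha hb
    have hpos : (ω : Ordinal.{0}) ^ e ≠ 0 := (Ordinal.opow_pos _ Ordinal.omega0_pos).ne'
    obtain ⟨n, hn⟩ := Ordinal.lt_omega0.1 (div_opow_lt_omega0 ha)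
    obtain ⟨m, hm⟩ := Ordinal.lt_omega0.1 (div_opow_lt_omega0 hb)
    obtain ⟨hlt, hmono⟩ := ih _ _ (Ordinal.mod_lt a hpos) (Ordinal.mod_lt b hpos)
    have hab := natSum_eq_of_lt ha hb
    rw [hn, hm] at hab
    refine ⟨?_, fun a' b' haa hbb => ?_⟩
    · rw [hab, Ordinal.opow_add_one, ← Nat.cast_add]
      calc _ < ω ^ e * ((n + m : ℕ) : Ordinal) + ω ^ e := by gcongr
        _ = ω ^ e * ((n + m + 1 : ℕ) : Ordinal) := by
          rw [Nat.cast_add_one (n + m), mul_add, mul_one]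
        _ ≤ _ := by gcongr; exact (Ordinal.natCast_lt_omega0 _).le
    · have ha' := haa.trans_lt ha
      have hb' := hbb.trans_lt hb
      obtain ⟨n', hn'⟩ := Ordinal.lt_omega0.1 (div_opow_lt_omega0 ha')
      obtain ⟨m', hm'⟩ := Ordinal.lt_omega0.1 (div_opow_lt_omega0 hb')
      have hab' := natSum_eq_of_lt ha' hb'
      rw [hn', hm'] at hab'
      have hnn : n' ≤ n := by
        have := Ordinal.div_le_left haa (ω ^ e)
        rw [hn, hn'] at this
        exact_mod_cast this
      have hmm : m' ≤ m := by
        have := Ordinal.div_le_left hbb (ω ^ e)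
        rw [hm, hm'] at this
        exact_mod_cast this
      obtain ⟨hlt', -⟩ := ih _ _ (Ordinal.mod_lt a' hpos) (Ordinal.mod_lt b' hpos)
      rcases (add_le_add hnn hmm).lt_or_eq with h | h
      · have key : natSum a' b' < natSum a b := by
          rw [hab, hab', ← Nat.cast_add, ← Nat.cast_add]
          calc _ < ω ^ e * ((n' + m' : ℕ) : Ordinal) + ω ^ e := by gcongr
            _ = ω ^ e * ((n' + m' + 1 : ℕ) : Ordinal) := by
              rw [Nat.cast_add_one (n' + m'), mul_add, mul_one]
            _ ≤ ω ^ e * ((n + m : ℕ) : Ordinal) := by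
              have h' : ((n' + m' + 1 : ℕ) : Ordinal.{0}) ≤ ((n + m : ℕ) : Ordinal.{0}) := by
                exact_mod_cast h
              gcongr
            _ ≤ _ := le_self_add
        exact ⟨key.le, fun h => absurd h key.ne⟩
      · obtain rfl : n' = n := by omega
        obtain rfl : m' = m := by omega
        have ea := Ordinal.div_add_mod a (ω ^ e)
        have ea' := Ordinal.div_add_mod a' (ω ^ e)
        have eb := Ordinal.div_add_mod b (ω ^ e)
        have eb' := Ordinal.div_add_mod b' (ω ^ e)
        rw [hn] at ea
        rw [hn'] at ea'
        rw [hm] at eb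
        rw [hm'] at eb'
        have h1 : a' % ω ^ e ≤ a % ω ^ e := by
          rw [← ea, ← ea'] at haa
          exact (add_le_add_iff_left _).1 haa
        have h2 : b' % ω ^ e ≤ b % ω ^ e := by
          rw [← eb, ← eb'] at hbb
          exact (add_le_add_iff_left _).1 hbb
        obtain ⟨k1, k2⟩ := hmono _ _ h1 h2
        rw [hab, hab']
        refine ⟨by gcongr, fun h => ?_⟩
        obtain ⟨r1, r2⟩ := k2 (add_left_cancel h)
        rw [← ea, ← ea', ← eb, ← eb', r1, r2]
        exact ⟨rfl, rfl⟩
  | limit ξ hξ ih =>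
    intro a b ha hb
    obtain ⟨e, he, hle⟩ := (Ordinal.lt_opow_of_isSuccLimit Ordinal.omega0_ne_zero hξ).1
      (max_lt ha hb)
    obtain ⟨h1, h2⟩ := ih e he a b (le_max_left _ _ |>.trans_lt hle)
      (le_max_right _ _ |>.trans_lt hle)
    exact ⟨h1.trans ((Ordinal.opow_lt_opow_iff_right Ordinal.one_lt_omega0).2 he), h2⟩

/-! ### Derivations and rank functions -/

section Derivation

variable {K : Type*} {D : Set K → Set K}

theorem iter_antitone (hD : ∀ S, D S ⊆ S) (H : Set K) : Antitone (iter D H) := by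
  intro a b hab
  induction b using Ordinal.limitRecOn with
  | zero => rw [nonpos_iff_eq_zero.1 hab]
  | add_one b ih =>
    rcases hab.lt_or_eq with h | rfl
    · rw [← Order.succ_eq_add_one, iter_succ]
      exact (hD _).trans (ih (Order.lt_add_one_iff.1 h))
    · exact subset_rfl
  | limit b hb ih =>
    rcases hab.lt_or_eq with h | rfl
    · rw [iter_limit _ _ _ hb]
      exact Set.iInter₂_subset a h
    · exact subset_rfl

theorem iter_add (D : Set K → Set K) (hD : ∀ S, D S ⊆ S) (H : Set K) (a b : Ordinal.{0}) :
    iter D H (a + b) = iter D (iter D H a) b := by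
  induction b using Ordinal.limitRecOn with
  | zero => rw [add_zero, iter_zero]
  | add_one b ih =>
    rw [← add_assoc, ← Order.succ_eq_add_one, iter_succ, ← Order.succ_eq_add_one, iter_succ, ih]
  | limit b hb ih =>
    rw [iter_limit _ _ _ (Ordinal.isSuccLimit_add a hb), iter_limit _ _ _ hb]
    refine Set.Subset.antisymm ?_ ?_
    · refine Set.subset_iInter₂ fun c hc => ?_
      rw [← ih c hc]
      exact Set.iInter₂_subset (a + c) (by gcongr)
    · refine Set.subset_iInter₂ fun c hc => ?_
      obtain ⟨d, hd, hcd⟩ : ∃ d < b, c ≤ a + d :=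
        (Ordinal.lt_add_iff_of_isSuccLimit hb).1 hc |>.imp fun _ h => ⟨h.1, h.2.le⟩
      refine (Set.iInter₂_subset d hd).trans ?_
      rw [← ih d hd]
      exact iter_antitone hD H hcd

theorem isClosed_iter [TopologicalSpace K] (hD : ∀ S, IsClosed S → IsClosed (D S)) {H : Set K}
    (hH : IsClosed H) (a : Ordinal.{0}) : IsClosed (iter D H a) := by
  induction a using Ordinal.limitRecOn with
  | zero => rwa [iter_zero]
  | add_one b ih => rw [← Order.succ_eq_add_one, iter_succ]; exact hD _ ih
  | limit b hb ih =>
    rw [iter_limit _ _ _ hb]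
    exact isClosed_iInter fun c => isClosed_iInter fun hc => ih c hc

/-- A point outside some iterate is lost at a successor step. -/
theorem exists_notMem_iter_succ {x : K} {o : Ordinal.{0}} (hx : x ∉ iter D Set.univ o) :
    ∃ a < o, x ∉ iter D Set.univ (Order.succ a) := by
  induction o using Ordinal.limitRecOn with
  | zero => simp [iter_zero] at hx
  | add_one b ih => exact ⟨b, Order.lt_add_one_iff.2 le_rfl, hx⟩
  | limit b hb ih =>
    rw [iter_limit _ _ _ hb] at hx
    simp only [Set.mem_iInter, not_forall] at hx
    obtain ⟨c, hc, hxc⟩ := hx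
    obtain ⟨a, ha, h⟩ := ih c hc hxc
    exact ⟨a, ha.trans hc, h⟩

/-- The rank is the index `a` with `x` in the `a`-th iterate but not in the next. Closedness of the
iterates gives upper semicontinuity, and `{y | ρ x ≤ ρ y}` lies in the iterate of index `ρ x`. -/
theorem exists_rankFunction [TopologicalSpace K] (hD : ∀ S, D S ⊆ S)
    (hDc : ∀ S, IsClosed S → IsClosed (D S)) (hDm : Monotone D) {o : Ordinal.{0}}
    (ho : iter D Set.univ o = ∅) :
    ∃ ρ : K → Ordinal.{0}, (∀ x, ρ x < o) ∧
      ∀ x, (∀ᶠ y in 𝓝 x, ρ y ≤ ρ x) ∧ x ∉ D {y | ρ x ≤ ρ y} := by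
  have hne : ∀ x, ∃ a < o, x ∉ iter D Set.univ (Order.succ a) := fun x =>
    exists_notMem_iter_succ (by simp [ho])
  let ρ : K → Ordinal.{0} := fun x => sInf {a | x ∉ iter D Set.univ (Order.succ a)}
  have hmem : ∀ x, x ∉ iter D Set.univ (Order.succ (ρ x)) := fun x =>
    csInf_mem (s := {a | x ∉ iter D Set.univ (Order.succ a)}) ((hne x).imp fun _ h => h.2)
  have hle : ∀ x a, x ∉ iter D Set.univ (Order.succ a) → ρ x ≤ a := fun x a h =>
    csInf_le' (s := {a | x ∉ iter D Set.univ (Order.succ a)}) h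
  have hin : ∀ x, x ∈ iter D Set.univ (ρ x) := by
    intro x
    by_contra h
    obtain ⟨a, ha, h⟩ := exists_notMem_iter_succ h
    exact (hle x a h).not_gt ha
  refine ⟨ρ, fun x => ?_, fun x => ⟨?_, fun hx => ?_⟩⟩
  · obtain ⟨a, ha, h⟩ := hne x
    exact (hle x a h).trans_lt ha
  · filter_upwards [(isClosed_iter hDc isClosed_univ _).isOpen_compl.mem_nhds (hmem x)] with y hy
    exact hle y _ hy
  · refine hmem x ?_
    rw [iter_succ]
    exact hDm (fun y hy => iter_antitone hD _ hy (hin y)) hx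

/-- By induction the `a`-th iterate stays inside `{x | a ≤ ρ x}`. -/
theorem iter_eq_empty_of_rankFunction (hD : ∀ S, D S ⊆ S) (hDm : Monotone D) {o : Ordinal.{0}}
    (ρ : K → Ordinal.{0}) (hρ : ∀ x, ρ x < o) (h : ∀ x, x ∉ D {y | ρ x ≤ ρ y}) :
    iter D Set.univ o = ∅ := by
  have key : ∀ a, iter D Set.univ a ⊆ {x | a ≤ ρ x} := by
    intro a
    induction a using Ordinal.limitRecOn with
    | zero => exact fun x _ => (zero_le : 0 ≤ ρ x)
    | add_one b ih =>
      rw [← Order.succ_eq_add_one, iter_succ]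
      intro x hx
      have hb : b ≤ ρ x := ih (hD _ hx)
      refine Order.succ_le_of_lt (hb.lt_of_ne ?_)
      rintro rfl
      exact h x (hDm ih hx)
    | limit b hb ih =>
      rw [iter_limit _ _ _ hb]
      intro x hx
      refine hb.le_iff_forall_le.2 fun c hc => ih c hc (Set.mem_iInter₂.1 hx c hc)
  exact Set.eq_empty_of_forall_notMem fun x hx => (key o hx).not_gt (hρ x)

/-- Countability of `o` excludes the default value `ω₁` of the rank. -/
theorem rank_le_iff (hD : ∀ S, D S ⊆ S) {H : Set K} {o : Ordinal.{0}} (ho : o < ω₁) :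
    rank D H ≤ o ↔ iter D H o = ∅ := by
  constructor
  · intro h
    unfold rank at h
    split_ifs at h with hex
    · obtain ⟨α, -, hα⟩ := hex
      have hmem : iter D H (sInf {α : Ordinal.{0} | iter D H α = ∅}) = ∅ :=
        csInf_mem (s := {α : Ordinal.{0} | iter D H α = ∅}) ⟨α, hα⟩
      exact Set.subset_empty_iff.1 (hmem ▸ iter_antitone hD H h)
    · exact absurd ho h.not_gt
  · intro h
    rw [rank, if_pos ⟨o, ho, h⟩]
    exact csInf_le' h

end Derivation

theorem omega0_opow_lt_omega_one {ξ : Ordinal.{0}} (hξ : ξ < ω₁) : ω ^ ξ < ω₁ :=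
  Ordinal.isPrincipal_opow_omega 1 Ordinal.omega0_lt_omega_one hξ

/-! ### Oscillation and convergence indices in terms of rank functions -/

section Indices

variable {K : Type*} [TopologicalSpace K]

theorem oscDeriv_subset (f : K → ℝ) (ε : ℝ) (S : Set K) : oscDeriv f ε S ⊆ S := fun _ h => h.1

theorem oscDeriv_mono (f : K → ℝ) (ε : ℝ) : Monotone (oscDeriv f ε) := by
  intro S T hST x hx
  refine ⟨hST hx.1, fun U hU hxU => ?_⟩
  obtain ⟨y, hy, z, hz, h⟩ := hx.2 U hU hxU
  exact ⟨y, ⟨hy.1, hST hy.2⟩, z, ⟨hz.1, hST hz.2⟩, h⟩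

theorem isClosed_oscDeriv (f : K → ℝ) (ε : ℝ) (S : Set K) (hS : IsClosed S) :
    IsClosed (oscDeriv f ε S) := by
  refine isClosed_of_closure_subset fun x hx => ⟨?_, fun U hU hxU => ?_⟩
  · exact closure_minimal (oscDeriv_subset f ε S) hS hx
  · obtain ⟨y, hyU, hy⟩ := mem_closure_iff.1 hx U hU hxU
    exact hy.2 U hU hyU

theorem convDeriv_subset (F : ℕ → K → ℝ) (ε : ℝ) (S : Set K) : convDeriv F ε S ⊆ S :=
  fun _ h => h.1

theorem convDeriv_mono (F : ℕ → K → ℝ) (ε : ℝ) : Monotone (convDeriv F ε) := by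
  intro S T hST x hx
  refine ⟨hST hx.1, fun U hU hxU m => ?_⟩
  obtain ⟨n₁, n₂, h₁, h₂, y, hy, h⟩ := hx.2 U hU hxU m
  exact ⟨n₁, n₂, h₁, h₂, y, ⟨hy.1, hST hy.2⟩, h⟩

/-- For every `ε > 0` there is an upper semicontinuous `ρ : K → o` such that `f` is locally
`ε`-constant on each level set of `ρ`. -/
def HasOscRank (f : K → ℝ) (o : Ordinal.{0}) : Prop :=
  ∀ ε > 0, ∃ ρ : K → Ordinal.{0}, (∀ x, ρ x < o) ∧
    ∀ x, ∀ᶠ y in 𝓝 x, ρ y ≤ ρ x ∧ (ρ y = ρ x → |f y - f x| < ε)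

/-- For every `ε > 0` there is an upper semicontinuous `ρ : K → o` such that `F` is locally
uniformly `ε`-Cauchy on each level set of `ρ`. -/
def HasConvRank (F : ℕ → K → ℝ) (o : Ordinal.{0}) : Prop :=
  ∀ ε > 0, ∃ ρ : K → Ordinal.{0}, (∀ x, ρ x < o) ∧
    ∀ x, ∃ m : ℕ, ∀ᶠ y in 𝓝 x, ρ y ≤ ρ x ∧
      (ρ y = ρ x → ∀ n₁ > m, ∀ n₂ > m, |F n₁ y - F n₂ y| < ε)

theorem oscIndex_le_iff_iter {f : K → ℝ} {o : Ordinal.{0}} (ho : o < ω₁) :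
    oscIndex f ≤ o ↔ ∀ ε > 0, iter (oscDeriv f ε) Set.univ o = ∅ := by
  unfold oscIndex
  rw [Ordinal.iSup_le_iff]
  simp [rank_le_iff (oscDeriv_subset f _) ho]

theorem convIndex_le_iff_iter {F : ℕ → K → ℝ} {o : Ordinal.{0}} (ho : o < ω₁) :
    convIndex F ≤ o ↔ ∀ ε > 0, iter (convDeriv F ε) Set.univ o = ∅ := by
  unfold convIndex
  rw [ciSup_le_iff' (bddAbove_rank fun ε => convDeriv F ε)]
  simp [rank_le_iff (convDeriv_subset F _) ho]

theorem oscIndex_le_iff {f : K → ℝ} {o : Ordinal.{0}} (ho : o < ω₁) :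
    oscIndex f ≤ o ↔ HasOscRank f o := by
  rw [oscIndex_le_iff_iter ho]
  constructor
  · intro h ε hε
    obtain ⟨ρ, hρ, hx⟩ := exists_rankFunction (oscDeriv_subset f ε) (isClosed_oscDeriv f ε)
      (oscDeriv_mono f ε) (h ε hε)
    refine ⟨ρ, hρ, fun x => (hx x).1.and ?_⟩
    have h2 := (hx x).2
    simp only [oscDeriv, Set.mem_ofPred_eq, le_refl, true_and, not_forall] at h2
    obtain ⟨U, hU, hxU, h2⟩ := h2
    filter_upwards [hU.mem_nhds hxU] with y hy hyx
    by_contra h3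
    exact h2 ⟨y, ⟨hy, hyx.ge⟩, x, ⟨hxU, le_refl (ρ x)⟩, not_lt.1 h3⟩
  · intro h ε hε
    -- Two points on the level of `x` are each compared with `x`, whence the half.
    obtain ⟨ρ, hρ, hx⟩ := h (ε / 2) (half_pos hε)
    refine iter_eq_empty_of_rankFunction (oscDeriv_subset f ε) (oscDeriv_mono f ε) ρ hρ
      fun x hD => ?_
    obtain ⟨U, hU, hUo, hxU⟩ := eventually_nhds_iff.1 (hx x)
    obtain ⟨y, hy, z, hz, hyz⟩ := hD.2 U hUo hxU
    have h1 := (hU y hy.1).2 (le_antisymm (hU y hy.1).1 hy.2)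
    have h2 := (hU z hz.1).2 (le_antisymm (hU z hz.1).1 hz.2)
    rw [abs_lt] at h1 h2
    exact hyz.not_gt (abs_lt.2 ⟨by linarith, by linarith⟩)

theorem convIndex_le_of_hasConvRank {F : ℕ → K → ℝ} {o : Ordinal.{0}} (ho : o < ω₁)
    (h : HasConvRank F o) : convIndex F ≤ o := by
  rw [convIndex_le_iff_iter ho]
  intro ε hε
  obtain ⟨ρ, hρ, hx⟩ := h ε hε
  refine iter_eq_empty_of_rankFunction (convDeriv_subset F ε) (convDeriv_mono F ε) ρ hρ
    fun x hD => ?_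
  obtain ⟨m, hm⟩ := hx x
  obtain ⟨U, hU, hUo, hxU⟩ := eventually_nhds_iff.1 hm
  obtain ⟨n₁, n₂, h₁, h₂, y, hy, hyn⟩ := hD.2 U hUo hxU m
  exact hyn.not_gt ((hU y hy.1).2 (le_antisymm (hU y hy.1).1 hy.2) n₁ (h₂.trans h₁) n₂ h₂)

theorem HasOscRank.continuous {f : K → ℝ} (h : HasOscRank f 1) : Continuous f := by
  rw [continuous_iff_continuousAt]
  intro x
  rw [ContinuousAt, Metric.tendsto_nhds]
  intro ε hε
  obtain ⟨ρ, hρ, hx⟩ := h ε hε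
  filter_upwards [hx x] with y hy
  simp only [Order.lt_one_iff] at hρ
  exact hy.2 (by rw [hρ, hρ])

/-- Composition of a pair of functions with a map that is `1`-Lipschitz for the `ℓ¹` norm. -/
theorem HasOscRank.comp₂ {f g : K → ℝ} {ξ : Ordinal.{0}} (hf : HasOscRank f (ω ^ ξ))
    (hg : HasOscRank g (ω ^ ξ)) (φ : ℝ → ℝ → ℝ)
    (hφ : ∀ a b c d, |φ a b - φ c d| ≤ |a - c| + |b - d|) :
    HasOscRank (fun x => φ (f x) (g x)) (ω ^ ξ) := by
  intro ε hε
  obtain ⟨ρ, hρ, hx⟩ := hf (ε / 2) (half_pos hε)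
  obtain ⟨σ, hσ, hy⟩ := hg (ε / 2) (half_pos hε)
  -- Near `x` neither rank exceeds its value at `x`, so equality of the natural sums forces equality
  -- of both ranks.
  refine ⟨fun x => natSum (ρ x) (σ x), fun x => (natSum_spec ξ _ _ (hρ x) (hσ x)).1, fun x => ?_⟩
  filter_upwards [hx x, hy x] with z hz hz'
  obtain ⟨h1, h2⟩ := (natSum_spec ξ _ _ (hρ x) (hσ x)).2 _ _ hz.1 hz'.1
  refine ⟨h1, fun h => ?_⟩
  obtain ⟨h3, h4⟩ := h2 h
  have := hz.2 h3
  have := hz'.2 h4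
  have := hφ (f z) (g z) (f x) (g x)
  linarith

/-- The oscillation index of a pointwise limit is at most the product of the oscillation indices of
the terms and the convergence index. -/
theorem oscIndex_le_of_ptwiseLim {F : ℕ → K → ℝ} {f : K → ℝ} {a b : Ordinal.{0}} (ha : a < ω₁)
    (hb : b < ω₁) (hab : a * b < ω₁) (hF : ∀ n, oscIndex (F n) ≤ a) (hlim : PtwiseLim F f)
    (hconv : convIndex F ≤ b) : oscIndex f ≤ a * b := by
  rw [oscIndex_le_iff_iter hab]
  rw [convIndex_le_iff_iter hb] at hconv
  intro ε hε
  -- Two errors of `ε / 4` still leave oscillation at least `ε / 2` for the approximating term, more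
  -- than the `ε / 4` required.
  have hδ : 0 < ε / 4 := by positivity
  have key : ∀ c, iter (oscDeriv f ε) Set.univ (a * c) ⊆ iter (convDeriv F (ε / 4)) Set.univ c := by
    intro c
    induction c using Ordinal.limitRecOn with
    | zero => rw [iter_zero]; exact Set.subset_univ _
    | add_one c ih =>
      rw [mul_add, mul_one, iter_add _ (oscDeriv_subset f ε), ← Order.succ_eq_add_one, iter_succ]
      set L := iter (oscDeriv f ε) Set.univ (a * c)
      set P := iter (convDeriv F (ε / 4)) Set.univ c
      intro x hx
      have hxP : x ∈ P := ih (by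
        have := iter_antitone (oscDeriv_subset f ε) L (zero_le (a := a)) hx
        rwa [iter_zero] at this)
      by_contra hnot
      simp only [convDeriv, Set.mem_ofPred_eq, hxP, true_and, not_forall] at hnot
      obtain ⟨U, hU, hxU, m, hm⟩ := hnot
      -- Off the convergence derivative all terms beyond `m` are uniformly close on `U ∩ L`; let the
      -- larger index tend to infinity.
      have hclose : ∀ y ∈ U ∩ L, |f y - F (m + 1) y| ≤ ε / 4 := by
        intro y hy
        have ht : Tendsto (fun n => |F n y - F (m + 1) y|) atTop (𝓝 |f y - F (m + 1) y|) :=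
          ((hlim y).sub_const _).abs
        refine le_of_tendsto ht ?_
        filter_upwards [eventually_gt_atTop (m + 1)] with n hn
        by_contra h
        exact hm ⟨n, m + 1, hn, Nat.lt_succ_self m, y, ⟨hy.1, ih hy.2⟩, (not_le.1 h).le⟩
      -- Inside `U`, oscillation of `f` forces oscillation of `F (m + 1)`, whose iterates are
      -- exhausted after `a` steps.
      have hsub : ∀ d, iter (oscDeriv f ε) L d ∩ U ⊆
          iter (oscDeriv (F (m + 1)) (ε / 4)) Set.univ d := by
        intro d
        induction d using Ordinal.limitRecOn with
        | zero => rw [iter_zero, iter_zero]; exact Set.subset_univ _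
        | add_one d ihd =>
          rw [← Order.succ_eq_add_one, iter_succ, iter_succ]
          rintro y ⟨hy, hyU⟩
          refine ⟨ihd ⟨hy.1, hyU⟩, fun V hV hyV => ?_⟩
          obtain ⟨z, hz, w, hw, hzw⟩ := hy.2 (V ∩ U) (hV.inter hU) ⟨hyV, hyU⟩
          refine ⟨z, ⟨hz.1.1, ihd ⟨hz.2, hz.1.2⟩⟩, w, ⟨hw.1.1, ihd ⟨hw.2, hw.1.2⟩⟩, ?_⟩
          have hL : iter (oscDeriv f ε) L d ⊆ L := by
            have := iter_antitone (oscDeriv_subset f ε) L (zero_le (a := d))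
            rwa [iter_zero] at this
          have h1 := hclose z ⟨hz.1.2, hL hz.2⟩
          have h2 := hclose w ⟨hw.1.2, hL hw.2⟩
          have h3 : |f z - f w| ≤ |f z - F (m + 1) z| + |F (m + 1) z - F (m + 1) w| +
              |f w - F (m + 1) w| := by
            rw [abs_sub_comm (f w)]
            refine (le_of_eq ?_).trans (abs_add_three _ _ _)
            congr 1
            ring
          linarith
        | limit d hd ihd =>
          rw [iter_limit _ _ _ hd, iter_limit _ _ _ hd]
          rintro y ⟨hy, hyU⟩
          exact Set.mem_iInter₂.2 fun e he => ihd e he ⟨Set.mem_iInter₂.1 hy e he, hyU⟩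
      have hempty := (oscIndex_le_iff_iter ha).1 (hF (m + 1)) (ε / 4) hδ
      have := hsub a ⟨hx, hxU⟩
      rwa [hempty] at this
    | limit c hc ih =>
      rw [iter_limit _ _ _ hc]
      exact Set.subset_iInter₂ fun d hd =>
        (iter_antitone (oscDeriv_subset f ε) _ (by gcongr)).trans (ih d hd)
  exact Set.subset_empty_iff.1 (hconv (ε / 4) hδ ▸ key b)

end Indices

/-! ### Extension from closed sets and approximating sequences -/

section Metric

variable {K : Type*} [MetricSpace K]

/-- A function on `Cᶜ` which is continuous and takes values in the convex hull of the values of `g`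
at almost nearest points of `C`. -/
theorem exists_continuousOn_compl_mem_convexHull {C : Set K} (hC : IsClosed C) (hne : C.Nonempty)
    (g : K → ℝ) : ∃ G : K → ℝ, ContinuousOn G Cᶜ ∧
      ∀ y ∉ C, G y ∈ convexHull ℝ (g '' {a | a ∈ C ∧ dist y a < 2 * Metric.infDist y C}) := by
  classical
  obtain ⟨G, hG⟩ := exists_continuous_forall_mem_convex_of_local_const (X := (Cᶜ : Set K))
    (t := fun y => convexHull ℝ (g '' {a | a ∈ C ∧ dist (y : K) a < 2 * Metric.infDist (y : K) C}))
    (fun _ => convex_convexHull ℝ _) (by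
      rintro ⟨y, hy⟩
      have hpos : 0 < Metric.infDist y C := (hC.notMem_iff_infDist_pos hne).1 hy
      obtain ⟨a, ha, hya⟩ := (Metric.infDist_lt_iff hne).1
        (show Metric.infDist y C < 2 * Metric.infDist y C by linarith)
      -- A nearly nearest point `a` of `C` stays nearly nearest for all points close to `y`, so the
      -- constant `g a` is a local selection.
      refine ⟨g a, ?_⟩
      have hopen : IsOpen {z : (Cᶜ : Set K) | dist (z : K) a < 2 * Metric.infDist (z : K) C} :=
        isOpen_lt (by fun_prop)
          (continuous_const.mul ((Metric.continuous_infDist_pt C).comp continuous_subtype_val))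
      filter_upwards [hopen.mem_nhds (show _ from hya)] with z hz
      exact subset_convexHull ℝ _ ⟨a, ⟨ha, hz⟩, rfl⟩)
  refine ⟨fun y => if h : y ∈ C then 0 else G ⟨y, h⟩, ?_, fun y hy => ?_⟩
  · rw [continuousOn_iff_continuous_domRestrict]
    convert G.continuous using 1
    ext ⟨y, hy⟩
    exact dif_neg hy
  · simp only [hy, dite_false]
    exact hG ⟨y, hy⟩

/-- Off `C` the extension is continuous and gets rank `0`. Such points share the level of a nearby
`x ∈ C` only if `σ x = 0`; then `σ = 0` on `C` near `x`, so the values of `g` being averaged lie in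
the convex ball of radius `ε` about `g x`. -/
theorem exists_extension_hasOscRank {C : Set K} (hC : IsClosed C) (g : K → ℝ) {o : Ordinal.{0}}
    (ho : 0 < o)
    (h : ∀ ε > 0, ∃ σ : K → Ordinal.{0}, (∀ x, σ x < o) ∧
      ∀ x ∈ C, ∀ᶠ y in 𝓝[C] x, σ y ≤ σ x ∧ (σ y = σ x → |g y - g x| < ε)) :
    ∃ G : K → ℝ, Set.EqOn G g C ∧ HasOscRank G o := by
  classical
  rcases C.eq_empty_or_nonempty with rfl | hne
  · refine ⟨fun _ => 0, fun x hx => hx.elim, fun ε hε => ⟨fun _ => 0, fun _ => ho, fun x => ?_⟩⟩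
    simp [hε]
  obtain ⟨G, hGc, hG⟩ := exists_continuousOn_compl_mem_convexHull hC hne g
  refine ⟨fun y => if y ∈ C then g y else G y, fun y hy => if_pos hy, fun ε hε => ?_⟩
  obtain ⟨σ, hσ, hx⟩ := h ε hε
  refine ⟨fun y => if y ∈ C then σ y else 0, fun y => ?_, fun x => ?_⟩
  · dsimp only
    split_ifs
    exacts [hσ y, ho]
  by_cases hxC : x ∈ C
  · obtain ⟨δ, hδ, hball⟩ := Metric.mem_nhdsWithin_iff.1 (hx x hxC)
    -- A point of `C` within `2 * infDist y C ≤ 2 * dist y x` of `y` is within `3 * dist y x < δ` of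
    -- `x`.
    filter_upwards [Metric.ball_mem_nhds x (show 0 < δ / 3 by positivity)] with y hy
    rw [Metric.mem_ball] at hy
    by_cases hyC : y ∈ C
    · simp only [hxC, hyC, if_true]
      exact hball ⟨Metric.mem_ball.2 (by linarith), hyC⟩
    · simp only [hxC, hyC, if_true, if_false]
      refine ⟨zero_le, fun h0 => ?_⟩
      have hsub : g '' {a | a ∈ C ∧ dist y a < 2 * Metric.infDist y C} ⊆
          Metric.ball (g x) ε := by
        rintro _ ⟨a, ⟨haC, ha⟩, rfl⟩
        have h1 : Metric.infDist y C ≤ dist y x := Metric.infDist_le_dist_of_mem hxC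
        have h2 : dist a x ≤ dist y a + dist y x := by
          rw [dist_comm y a]
          exact dist_triangle _ _ _
        obtain ⟨h3, h4⟩ := hball ⟨Metric.mem_ball.2 (by linarith : dist a x < δ), haC⟩
        refine Metric.mem_ball.2 (h4 ?_)
        rw [← h0] at h3 ⊢
        exact nonpos_iff_eq_zero.1 h3
      exact Metric.mem_ball.1 (convexHull_min hsub (convex_ball _ _) (hG y hyC))
  · have hcont : ContinuousAt G x := hGc.continuousAt (hC.isOpen_compl.mem_nhds hxC)
    filter_upwards [hC.isOpen_compl.mem_nhds hxC, Metric.tendsto_nhds.1 hcont ε hε] with y hyC hy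
    have hyC : y ∉ C := hyC
    simp only [hxC, hyC, if_false, le_refl, true_and]
    exact fun _ => hy

/-- A function that is continuous on each level set of `ρ` and uniformly close to `f`. -/
theorem exists_continuous_on_levels {f : K → ℝ} {ε : ℝ} {ρ : K → Ordinal.{0}}
    (hρ : ∀ x, ∀ᶠ y in 𝓝 x, ρ y = ρ x → |f y - f x| < ε) :
    ∃ g : K → ℝ, (∀ x, |g x - f x| ≤ ε) ∧
      ∀ x, ∀ δ > 0, ∀ᶠ y in 𝓝 x, ρ y = ρ x → |g y - g x| < δ := by
  -- Each level is treated separately: continuity is only needed within levels, so no compatibility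
  -- between them is required.
  have H : ∀ c : Ordinal.{0}, ∃ g : C({y // ρ y = c}, ℝ), ∀ y : {y // ρ y = c},
      g y ∈ Metric.closedBall (f y) ε := by
    intro c
    refine exists_continuous_forall_mem_convex_of_local_const
      (fun _ => convex_closedBall _ _) ?_
    rintro ⟨x, rfl⟩
    refine ⟨f x, ?_⟩
    filter_upwards [continuous_subtype_val.continuousAt.eventually (hρ x)] with y hy
    rw [Metric.mem_closedBall, dist_comm]
    exact (hy y.2).le
  choose G hG using H
  have hGe : ∀ c y (hy : ρ y = c), G (ρ y) ⟨y, rfl⟩ = G c ⟨y, hy⟩ := by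
    rintro c y rfl
    rfl
  refine ⟨fun y => G (ρ y) ⟨y, rfl⟩, fun x => hG _ _, fun x δ hδ => ?_⟩
  obtain ⟨η, hη, h⟩ := Metric.continuousAt_iff.1 ((G (ρ x)).continuous.continuousAt
    (x := ⟨x, rfl⟩)) δ hδ
  filter_upwards [Metric.ball_mem_nhds x hη] with y hy hyx
  rw [hGe _ y hyx]
  exact h (x := ⟨y, hyx⟩) hy

/-- The points at distance at least `r` from all points of larger rank. -/
def separatedSet (α : K → Ordinal.{0}) (r : ℝ) : Set K := {y | ∀ z, α y < α z → r ≤ dist y z}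

/-- A point `y` of the set within `r` of `x` cannot have `α y < α x`, so semicontinuity gives
equality near `x`. The distance bound then passes to limit points. -/
theorem isClosed_separatedSet {α : K → Ordinal.{0}} (hα : ∀ x, ∀ᶠ y in 𝓝 x, α y ≤ α x) {r : ℝ}
    (hr : 0 < r) : IsClosed (separatedSet α r) ∧
      ∀ x, ∀ᶠ y in 𝓝[separatedSet α r] x, α y = α x := by
  have key : ∀ x, ∀ᶠ y in 𝓝[separatedSet α r] x, α y = α x := by
    intro x
    filter_upwards [nhdsWithin_le_nhds (hα x), self_mem_nhdsWithin,
      nhdsWithin_le_nhds (Metric.ball_mem_nhds x hr)] with y h1 h2 h3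
    refine h1.eq_of_not_lt fun h => ?_
    exact (h2 x h).not_gt h3
  refine ⟨isClosed_iff_frequently.2 fun x hx z hxz => ?_, key⟩
  refine le_of_forall_pos_lt_add fun δ hδ => ?_
  obtain ⟨y, hy, hyx, hyδ⟩ := (hx.and_eventually
    ((eventually_nhdsWithin_iff.1 (key x)).and (Metric.ball_mem_nhds x hδ))).exists
  have := hy z (by rwa [hyx hy])
  have h2 : dist y x < δ := hyδ
  linarith [dist_triangle y x z]

/-- If `α ≤ α x` on a ball about `x`, points of larger rank lie outside it, hence at least half its
radius away from the concentric half ball. -/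
theorem exists_eventually_mem_separatedSet {α : K → Ordinal.{0}}
    (hα : ∀ x, ∀ᶠ y in 𝓝 x, α y ≤ α x) (x : K) :
    ∃ δ > 0, ∀ᶠ y in 𝓝 x, α y = α x → y ∈ separatedSet α δ := by
  obtain ⟨δ, hδ, h⟩ := Metric.eventually_nhds_iff.1 (hα x)
  refine ⟨δ / 2, half_pos hδ, ?_⟩
  filter_upwards [Metric.ball_mem_nhds x (half_pos hδ)] with y hy hyx z hz
  by_contra hlt
  have h1 : dist y x < δ / 2 := hy
  have := h (y := z) (by linarith [dist_triangle_left z x y])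
  exact (hyx ▸ hz).not_ge this

/-- Approximation of `f` up to `ε` by a function `g` which is the locally eventually constant limit,
on the level sets of a function `α : K → b`, of functions of oscillation rank `a`. -/
theorem exists_seq_eventually_eq_on_levels {f : K → ℝ} {a b : Ordinal.{0}} (ha : 0 < a) {ε : ℝ}
    {ρ : K → Ordinal.{0}} (hρ : ∀ x, ρ x < a * b)
    (h : ∀ x, ∀ᶠ y in 𝓝 x, ρ y ≤ ρ x ∧ (ρ y = ρ x → |f y - f x| < ε)) :
    ∃ (g : K → ℝ) (G : ℕ → K → ℝ) (α : K → Ordinal.{0}), (∀ x, |g x - f x| ≤ ε) ∧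
      (∀ n, HasOscRank (G n) a) ∧ (∀ x, α x < b) ∧
      ∀ x, ∃ m, ∀ᶠ y in 𝓝 x, α y ≤ α x ∧ (α y = α x → ∀ n ≥ m, G n y = g y) := by
  obtain ⟨g, hgf, hg⟩ := exists_continuous_on_levels fun x => (h x).mono fun _ h => h.2
  have hα : ∀ x, ∀ᶠ y in 𝓝 x, ρ y / a ≤ ρ x / a := fun x =>
    (h x).mono fun y hy => Ordinal.div_le_left hy.1 a
  have hext : ∀ n : ℕ, ∃ G : K → ℝ,
      Set.EqOn G g (separatedSet (fun x => ρ x / a) (1 / ((n : ℝ) + 1))) ∧ HasOscRank G a := by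
    intro n
    obtain ⟨hcl, hloc⟩ := isClosed_separatedSet hα (r := 1 / ((n : ℝ) + 1)) (by positivity)
    -- With the quotient locally constant on the closed set, the remainder inherits semicontinuity
    -- from `ρ`, and equal remainders mean equal `ρ`.
    refine exists_extension_hasOscRank hcl g ha fun δ hδ => ⟨fun x => ρ x % a,
      fun x => Ordinal.mod_lt _ ha.ne', fun x _ => ?_⟩
    filter_upwards [hloc x, nhdsWithin_le_nhds (h x), nhdsWithin_le_nhds (hg x δ hδ)]
      with y h1 h2 h3
    have hy := Ordinal.div_add_mod (ρ y) a
    have hx := Ordinal.div_add_mod (ρ x) a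
    rw [h1] at hy
    refine ⟨?_, fun h4 => h3 ?_⟩
    · exact (add_le_add_iff_left _).1 (hy.le.trans (h2.1.trans hx.ge))
    · exact (hy.symm.trans (congrArg _ h4)).trans hx
  choose G hGg hG using hext
  refine ⟨g, G, fun x => ρ x / a, hgf, hG, fun x => (Ordinal.lt_mul_iff_div_lt ha.ne').1 (hρ x),
    fun x => ?_⟩
  obtain ⟨δ, hδ, hev⟩ := exists_eventually_mem_separatedSet hα x
  obtain ⟨m, hm⟩ := exists_nat_one_div_lt hδ
  refine ⟨m, ?_⟩
  filter_upwards [hα x, hev] with y h1 h2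
  refine ⟨h1, fun h3 n hn => hGg n fun z hz => ?_⟩
  have h4 : (1 : ℝ) / ((n : ℝ) + 1) ≤ 1 / ((m : ℝ) + 1) := by gcongr
  exact h4.trans (hm.le.trans (h2 h3 z hz))

/-! ### Truncated corrections and the diagonal sequence -/

/-- The point of `[a - c, a + c]` nearest to `b`. -/
def clampAround (c a b : ℝ) : ℝ := max (a - c) (min b (a + c))

theorem abs_clampAround_sub_le (c a b a' b' : ℝ) :
    |clampAround c a b - clampAround c a' b'| ≤ |a - a'| + |b - b'| := by
  have h1 := abs_max_sub_max_le_max (a - c) (min b (a + c)) (a' - c) (min b' (a' + c))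
  have h2 := abs_min_sub_min_le_max b (a + c) b' (a' + c)
  rw [add_sub_add_right_eq_sub] at h2
  rw [sub_sub_sub_cancel_right] at h1
  have := abs_nonneg (a - a')
  have := abs_nonneg (b - b')
  refine h1.trans (max_le (by linarith) (h2.trans (max_le ?_ ?_))) <;> linarith

theorem abs_clampAround_sub_left_le {c : ℝ} (hc : 0 ≤ c) (a b : ℝ) :
    |clampAround c a b - a| ≤ c := by
  rw [abs_le, clampAround]
  constructor
  · linarith [le_max_left (a - c) (min b (a + c))]
  · linarith [max_le (by linarith : a - c ≤ a + c) (min_le_right b (a + c))]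

theorem clampAround_eq {c a b : ℝ} (h : |b - a| ≤ c) : clampAround c a b = b := by
  rw [abs_le] at h
  rw [clampAround, min_eq_left (by linarith), max_eq_right (by linarith)]

theorem HasOscRank.clampAround {X : Type*} [TopologicalSpace X] {f g : X → ℝ} {ξ : Ordinal.{0}}
    (hf : HasOscRank f (ω ^ ξ)) (hg : HasOscRank g (ω ^ ξ)) (c : ℝ) :
    HasOscRank (fun x => clampAround c (f x) (g x)) (ω ^ ξ) :=
  hf.comp₂ hg _ (abs_clampAround_sub_le c)

/-- Successive corrections of `G 0` by `G 1`, `G 2`, …, the `k`-th one by at most `2 * (1/2) ^ k`. -/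
def corrected {X : Type*} (G : ℕ → X → ℝ) : ℕ → X → ℝ
  | 0 => G 0
  | k + 1 => fun x => clampAround (2 * (1 / 2) ^ k) (corrected G k x) (G (k + 1) x)

theorem HasOscRank.corrected {X : Type*} [TopologicalSpace X] {G : ℕ → X → ℝ} {ξ : Ordinal.{0}}
    (hG : ∀ k, HasOscRank (G k) (ω ^ ξ)) (k : ℕ) : HasOscRank (corrected G k) (ω ^ ξ) := by
  induction k with
  | zero => exact hG 0
  | succ k ih => exact ih.clampAround (hG (k + 1)) _

/-- The bound is the geometric sum of the allowed corrections, valid whatever `G` does. -/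
theorem abs_corrected_sub_le {X : Type*} (G : ℕ → X → ℝ) (N j : ℕ) (x : X) :
    |corrected G (N + j) x - corrected G N x| ≤ 4 * (1 / 2) ^ N - 4 * (1 / 2) ^ (N + j) := by
  induction j with
  | zero => simp
  | succ j ih =>
    have h1 : |corrected G (N + j + 1) x - corrected G (N + j) x| ≤ 2 * (1 / 2) ^ (N + j) :=
      abs_clampAround_sub_left_le (by positivity) _ _
    have h2 := abs_sub_le (corrected G (N + j + 1) x) (corrected G (N + j) x) (corrected G N x)
    rw [← add_assoc, pow_succ _ (N + j)]
    linarith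

/-- Consecutive `g k x` differ by at most `2⁻ᵏ + 2⁻ᵏ⁻¹`, within the allowance `2 * 2⁻ᵏ`, so no
truncation occurs up to `N`. Later corrections total at most `4 * 2⁻ᴺ`, and `g N` itself errs by
`2⁻ᴺ`. -/
theorem abs_corrected_sub_le_of_eq {X : Type*} {G g : ℕ → X → ℝ} {f : X → ℝ} {x : X}
    (hg : ∀ k, |g k x - f x| ≤ (1 / 2) ^ k) {N n : ℕ} (hG : ∀ k ≤ N, G k x = g k x) (hn : N ≤ n) :
    |corrected G n x - f x| ≤ 5 * (1 / 2) ^ N := by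
  have heq : ∀ k ≤ N, corrected G k x = g k x := by
    intro k
    induction k with
    | zero => exact fun h => hG 0 h
    | succ k ih =>
      intro hk
      have h0 : corrected G (k + 1) x =
        BaireOne.clampAround (2 * (1 / 2) ^ k) (corrected G k x) (G (k + 1) x) := rfl
      rw [h0, ih (by omega), hG _ hk]
      refine clampAround_eq ?_
      have h1 := hg k
      have h2 := hg (k + 1)
      have h3 : (0 : ℝ) < (1 / 2) ^ k := by positivity
      rw [pow_succ] at h2
      rw [abs_le] at *
      constructor <;> linarith
  obtain ⟨j, rfl⟩ := Nat.exists_eq_add_of_le hn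
  have h1 := abs_corrected_sub_le G N j x
  rw [heq N le_rfl] at h1
  have h2 := hg N
  have h3 := abs_sub_le (corrected G (N + j) x) (g N x) (f x)
  have h4 : (0 : ℝ) < (1 / 2) ^ (N + j) := by positivity
  linarith

theorem exists_common_levels {X : Type*} [TopologicalSpace X] {ξ : Ordinal.{0}}
    {P : ℕ → ℕ → X → Prop} {α : ℕ → X → Ordinal.{0}} (hα : ∀ k x, α k x < ω ^ ξ)
    (h : ∀ k x, ∃ m, ∀ᶠ y in 𝓝 x, α k y ≤ α k x ∧ (α k y = α k x → ∀ n ≥ m, P k n y)) (N : ℕ) :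
    ∃ τ : X → Ordinal.{0}, (∀ x, τ x < ω ^ ξ) ∧ ∀ x, ∃ m, ∀ᶠ y in 𝓝 x, τ y ≤ τ x ∧
      (τ y = τ x → ∀ n ≥ m, ∀ k ≤ N, P k n y) := by
  induction N with
  | zero =>
    refine ⟨α 0, hα 0, fun x => ?_⟩
    obtain ⟨m, hm⟩ := h 0 x
    refine ⟨m, hm.mono fun y hy => ⟨hy.1, fun h n hn k hk => ?_⟩⟩
    obtain rfl : k = 0 := by omega
    exact hy.2 h n hn
  | succ N ih =>
    obtain ⟨τ, hτ, hx⟩ := ih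
    refine ⟨fun x => natSum (τ x) (α (N + 1) x),
      fun x => (natSum_spec ξ _ _ (hτ x) (hα _ x)).1, fun x => ?_⟩
    obtain ⟨m, hm⟩ := hx x
    obtain ⟨m', hm'⟩ := h (N + 1) x
    refine ⟨max m m', ?_⟩
    filter_upwards [hm, hm'] with y h1 h2
    obtain ⟨h3, h4⟩ := (natSum_spec ξ _ _ (hτ x) (hα (N + 1) x)).2 _ _ h1.1 h2.1
    refine ⟨h3, fun h5 n hn k hk => ?_⟩
    obtain ⟨h6, h7⟩ := h4 h5
    rcases Nat.le_succ_iff.1 hk with hk | rfl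
    · exact h1.2 h6 n ((le_max_left _ _).trans hn) k hk
    · exact h2.2 h7 n ((le_max_right _ _).trans hn)

/-- The `n`-th term corrects `G 0 n` successively by `G 1 n`, …, `G n n`. For a given `ε` only
finitely many `k` matter, the remaining corrections being uniformly small; so finitely many ranks `α
k` suffice, and their natural sum stays below `ω ^ ξ₂`. -/
theorem exists_seq_of_hasOscRank {f : K → ℝ} {ξ₁ ξ₂ : Ordinal.{0}}
    (hf : HasOscRank f (ω ^ ξ₁ * ω ^ ξ₂)) :
    ∃ F : ℕ → K → ℝ, (∀ n, HasOscRank (F n) (ω ^ ξ₁)) ∧ PtwiseLim F f ∧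
      HasConvRank F (ω ^ ξ₂) := by
  have hA : ∀ k : ℕ, ∃ (g : K → ℝ) (G : ℕ → K → ℝ) (α : K → Ordinal.{0}),
      (∀ x, |g x - f x| ≤ (1 / 2) ^ k) ∧ (∀ n, HasOscRank (G n) (ω ^ ξ₁)) ∧
      (∀ x, α x < ω ^ ξ₂) ∧
      ∀ x, ∃ m, ∀ᶠ y in 𝓝 x, α y ≤ α x ∧ (α y = α x → ∀ n ≥ m, G n y = g y) := by
    intro k
    obtain ⟨ρ, hρ, h⟩ := hf ((1 / 2) ^ k) (by positivity)
    exact exists_seq_eventually_eq_on_levels (Ordinal.opow_pos _ Ordinal.omega0_pos) hρ h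
  choose g G α hgf hG hα hev using hA
  have hclose : ∀ ε > 0, ∃ τ : K → Ordinal.{0}, (∀ x, τ x < ω ^ ξ₂) ∧ ∀ x, ∃ m : ℕ, ∀ᶠ y in 𝓝 x,
      τ y ≤ τ x ∧ (τ y = τ x → ∀ n ≥ m, |corrected (fun k => G k n) n y - f y| < ε) := by
    intro ε hε
    obtain ⟨N, hN⟩ := exists_pow_lt_of_lt_one (show 0 < ε / 5 by positivity)
      (show (1 / 2 : ℝ) < 1 by norm_num)
    obtain ⟨τ, hτ, hx⟩ := exists_common_levels (P := fun k n y => G k n y = g k y) hα hev N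
    refine ⟨τ, hτ, fun x => ?_⟩
    obtain ⟨m, hm⟩ := hx x
    refine ⟨max m N, hm.mono fun y hy => ⟨hy.1, fun h n hn => ?_⟩⟩
    have := abs_corrected_sub_le_of_eq (G := fun k => G k n) (fun k => hgf k y)
      (hy.2 h n ((le_max_left _ _).trans hn)) ((le_max_right _ _).trans hn)
    linarith
  refine ⟨fun n => corrected (fun k => G k n) n,
    fun n => HasOscRank.corrected (fun k => hG k n) n, fun x => ?_, fun ε hε => ?_⟩
  · rw [Metric.tendsto_atTop]
    intro ε hε
    obtain ⟨τ, -, hx⟩ := hclose ε hε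
    obtain ⟨m, hm⟩ := hx x
    exact ⟨m, fun n hn => hm.self_of_nhds.2 rfl n hn⟩
  · obtain ⟨τ, hτ, hx⟩ := hclose (ε / 2) (half_pos hε)
    refine ⟨τ, hτ, fun x => ?_⟩
    obtain ⟨m, hm⟩ := hx x
    refine ⟨m, hm.mono fun y hy => ⟨hy.1, fun h n₁ h₁ n₂ h₂ => ?_⟩⟩
    have h3 := hy.2 h n₁ h₁.le
    have h4 := hy.2 h n₂ h₂.le
    rw [abs_lt] at *
    constructor <;> linarith

/-- For `ξ₁ = 0` the approximants have rank below `1`: the whole space is one level, so they are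
continuous. -/
theorem isBaireOne_of_oscIndex_le {f : K → ℝ} {ξ : Ordinal.{0}} (hξ : ξ < ω₁)
    (hf : oscIndex f ≤ ω ^ ξ) : IsBaireOne f := by
  rw [oscIndex_le_iff (omega0_opow_lt_omega_one hξ)] at hf
  obtain ⟨F, hF, hlim, -⟩ := exists_seq_of_hasOscRank (ξ₁ := 0) (ξ₂ := ξ) (by simpa using hf)
  exact ⟨F, fun n => HasOscRank.continuous (by simpa using hF n), hlim⟩

theorem HasOscRank.clampAround_zero {X : Type*} [TopologicalSpace X] {f : X → ℝ} {ξ : Ordinal.{0}}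
    (hf : HasOscRank f (ω ^ ξ)) (c : ℝ) :
    HasOscRank (fun x => BaireOne.clampAround c 0 (f x)) (ω ^ ξ) :=
  hf.comp₂ hf (fun a _ => BaireOne.clampAround c 0 a) fun a b c' d => by
    have := abs_clampAround_sub_le c 0 a 0 c'
    simp only [sub_zero, abs_zero, zero_add] at this
    linarith [abs_nonneg (b - d)]

theorem exists_bounded_seq {f : K → ℝ} {ξ₁ ξ₂ : Ordinal.{0}} (hb : IsBdd f)
    (hf : HasOscRank f (ω ^ ξ₁ * ω ^ ξ₂)) :
    ∃ F : ℕ → K → ℝ, (∀ n, HasOscRank (F n) (ω ^ ξ₁)) ∧ IsUnifBdd F ∧ PtwiseLim F f ∧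
      HasConvRank F (ω ^ ξ₂) := by
  obtain ⟨F, hF, hlim, hconv⟩ := exists_seq_of_hasOscRank hf
  obtain ⟨M, hM⟩ := hb
  -- Truncation at `|M|` is `1`-Lipschitz and fixes the values of `f`. The absolute value covers
  -- empty `K`, where `M` may be negative.
  have hlip : ∀ a b, |clampAround |M| 0 a - clampAround |M| 0 b| ≤ |a - b| := fun a b => by
    simpa using abs_clampAround_sub_le |M| 0 a 0 b
  refine ⟨fun n x => clampAround |M| 0 (F n x), fun n => (hF n).clampAround_zero _,
    ⟨|M|, fun n x => ?_⟩, fun x => ?_, fun ε hε => ?_⟩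
  · simpa using abs_clampAround_sub_left_le (abs_nonneg M) 0 (F n x)
  · have hfx : clampAround |M| 0 (f x) = f x :=
      clampAround_eq (by simpa using (hM x).trans (le_abs_self M))
    have hcont : Continuous fun a => clampAround |M| 0 a := by
      unfold clampAround
      fun_prop
    have := (hcont.tendsto (f x)).comp (hlim x)
    rwa [hfx] at this
  · obtain ⟨ρ, hρ, hx⟩ := hconv ε hε
    refine ⟨ρ, hρ, fun x => ?_⟩
    obtain ⟨m, hm⟩ := hx x
    exact ⟨m, hm.mono fun y hy => ⟨hy.1, fun h n₁ h₁ n₂ h₂ =>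
      (hlip _ _).trans_lt (hy.2 h n₁ h₁ n₂ h₂)⟩⟩

end Metric

end BaireOne

end

/-! ### The three equivalences -/

theorem theorem1p2 {K : Type*} [MetricSpace K] [CompactSpace K]
    (ξ₁ ξ₂ : Ordinal.{0}) (hξ₁ : ξ₁ < ω₁) (hξ₂ : ξ₂ < ω₁) (f : K → ℝ) :
    (f ∈ BaireOne.SmallBaire K (ξ₁ + ξ₂) ↔
      ∃ F : ℕ → K → ℝ, (∀ n, F n ∈ BaireOne.SmallBaire K ξ₁) ∧
        BaireOne.PtwiseLim F f ∧ BaireOne.convIndex F ≤ ω ^ ξ₂) ∧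
    (f ∈ BaireOne.BddSmallBaire K (ξ₁ + ξ₂) ↔
      BaireOne.IsBdd f ∧
      ∃ F : ℕ → K → ℝ, (∀ n, F n ∈ BaireOne.BddSmallBaire K ξ₁) ∧
        BaireOne.PtwiseLim F f ∧ BaireOne.convIndex F ≤ ω ^ ξ₂) ∧
    (f ∈ BaireOne.BddSmallBaire K (ξ₁ + ξ₂) ↔
      ∃ F : ℕ → K → ℝ, (∀ n, F n ∈ BaireOne.BddSmallBaire K ξ₁) ∧
        BaireOne.IsUnifBdd F ∧ BaireOne.PtwiseLim F f ∧ BaireOne.convIndex F ≤ ω ^ ξ₂) := by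
  have h₁ := BaireOne.omega0_opow_lt_omega_one hξ₁
  have h₂ := BaireOne.omega0_opow_lt_omega_one hξ₂
  have hξ : ξ₁ + ξ₂ < ω₁ := Ordinal.isPrincipal_add_omega 1 hξ₁ hξ₂
  have h₁₂ := BaireOne.omega0_opow_lt_omega_one hξ
  have hmul : ω ^ (ξ₁ + ξ₂) = ω ^ ξ₁ * ω ^ ξ₂ := Ordinal.opow_add _ _ _
  have up : ∀ F : ℕ → K → ℝ, (∀ n, BaireOne.oscIndex (F n) ≤ ω ^ ξ₁) → BaireOne.PtwiseLim F f →
      BaireOne.convIndex F ≤ ω ^ ξ₂ →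
      BaireOne.IsBaireOne f ∧ BaireOne.oscIndex f ≤ ω ^ (ξ₁ + ξ₂) := by
    intro F hF hlim hconv
    have : BaireOne.oscIndex f ≤ ω ^ (ξ₁ + ξ₂) :=
      hmul ▸ BaireOne.oscIndex_le_of_ptwiseLim h₁ h₂ (hmul ▸ h₁₂) hF hlim hconv
    exact ⟨BaireOne.isBaireOne_of_oscIndex_le hξ this, this⟩
  have small : ∀ g : K → ℝ, BaireOne.HasOscRank g (ω ^ ξ₁) →
      BaireOne.IsBaireOne g ∧ BaireOne.oscIndex g ≤ ω ^ ξ₁ := fun g hg =>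
    have := (BaireOne.oscIndex_le_iff h₁).2 hg
    ⟨BaireOne.isBaireOne_of_oscIndex_le hξ₁ this, this⟩
  have down : BaireOne.oscIndex f ≤ ω ^ (ξ₁ + ξ₂) → BaireOne.HasOscRank f (ω ^ ξ₁ * ω ^ ξ₂) :=
    fun h => hmul ▸ (BaireOne.oscIndex_le_iff h₁₂).1 h
  have downBdd : f ∈ BaireOne.BddSmallBaire K (ξ₁ + ξ₂) →
      ∃ F : ℕ → K → ℝ, (∀ n, F n ∈ BaireOne.BddSmallBaire K ξ₁) ∧
        BaireOne.IsUnifBdd F ∧ BaireOne.PtwiseLim F f ∧ BaireOne.convIndex F ≤ ω ^ ξ₂ := by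
    rintro ⟨-, hb, hosc⟩
    obtain ⟨F, hF, ⟨M, hM⟩, hlim, hconv⟩ := BaireOne.exists_bounded_seq hb (down hosc)
    exact ⟨F, fun n => ⟨(small _ (hF n)).1, ⟨M, hM n⟩, (small _ (hF n)).2⟩, ⟨M, hM⟩, hlim,
      BaireOne.convIndex_le_of_hasConvRank h₂ hconv⟩
  refine ⟨⟨?_, ?_⟩, ⟨?_, ?_⟩, downBdd, ?_⟩
  · rintro ⟨-, hosc⟩
    obtain ⟨F, hF, hlim, hconv⟩ := BaireOne.exists_seq_of_hasOscRank (down hosc)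
    exact ⟨F, fun n => small _ (hF n), hlim, BaireOne.convIndex_le_of_hasConvRank h₂ hconv⟩
  · rintro ⟨F, hF, hlim, hconv⟩
    exact up F (fun n => (hF n).2) hlim hconv
  · intro hf
    obtain ⟨F, hF, -, hlim, hconv⟩ := downBdd hf
    exact ⟨hf.2.1, F, hF, hlim, hconv⟩
  · rintro ⟨hb, F, hF, hlim, hconv⟩
    obtain ⟨h, h'⟩ := up F (fun n => (hF n).2.2) hlim hconv
    exact ⟨h, hb, h'⟩
  · rintro ⟨F, hF, ⟨M, hM⟩, hlim, hconv⟩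
    obtain ⟨h, h'⟩ := up F (fun n => (hF n).2.2) hlim hconv
    exact ⟨h, ⟨M, fun x => le_of_tendsto' (hlim x).abs fun n => hM n x⟩, h'⟩
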